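/- Let $K$ be the fraction field of a Dedekind domain $\mathcal{O}_K$, and for a finite extension $L/K$ let $\mathcal{O}_L$ be the integral closure of $\mathcal{O}_K$ in $L$. Let $N/K$ be a finite Galois extension whose Galois group is an (internal) semidirect product $G=J\rtimes G'$ with $J$ normal in $G$, and put $E=N^{G'}$, $F=N^{J}$. Assume that $E/K$ and $F/K$ are arithmetically disjoint, that is, $E$ and $F$ are linearly disjoint over $K$ and $\mathcal{O}_{EF}=\mathcal{O}_E\mathcal{O}_F$. Let $H$ be a Hopf–Galois structure on $E/K$: a $K$-Hopf algebra $H$ with a $K$-linear action making $E$ an $H$-module algebra and such that $E\otimes_K H\to\mathrm{End}_K(E)$, $x\otimes h\mapsto(y\mapsto x(h\cdot y))$, is bijective. Let $H\otimes_K F$ act on $N=EF\cong E\otimes_K F$ by $(h\otimes f)\cdot(xg)=(h\cdot x)fg$ for $h\in H$, $x\in E$, $f,g\in F$. Define the associated orders $\mathfrak{A}_H=\{h\in H: h\cdot\mathcal{O}_E\subseteq\mathcal{O}_E\}$ and $\mathfrak{A}_{H\otimes_K F}=\{t\in H\otimes_K F: t\cdot\mathcal{O}_N\subseteq\mathcal{O}_N\}$.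 1. If $\mathcal{O}_E$ is a free $\mathfrak{A}_H$-module, then $\mathcal{O}_N$ is a free $\mathfrak{A}_{H\otimes_K F}$-module. 2. If moreover $\mathcal{O}_K$ has only finitely many maximal ideals (for instance, if $\mathcal{O}_K$ is a complete discrete valuation ring), then $\mathcal{O}_E$ is a free $\mathfrak{A}_H$-module if and only if $\mathcal{O}_N$ is a free $\mathfrak{A}_{H\otimes_K F}$-module. -/

import Mathlib

open scoped TensorProduct

/-- A Hopf-Galois structure on the field extension `L / K` with underlying `K`-Hopf algebra `H`:
a `K`-linear action of `H` on `L` (given as a representation `H → End_K(L)`) which makes `L` an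
`H`-module algebra and for which the canonical map
`L ⊗[K] H → End_K(L)`, `x ⊗ h ↦ (y ↦ x * (h · y))`, is bijective.
(For finite `L / K` the last condition forces `dim_K H = [L : K]`.) -/
structure HopfGaloisStructure (K L H : Type*) [Field K] [Field L] [Algebra K L]
    [Ring H] [HopfAlgebra K H] where
  /-- The action of `H` on `L`. -/
  action : H →ₐ[K] Module.End K L
  /-- `h · (x y) = ∑ (h₍₁₎ · x) (h₍₂₎ · y)`. -/
  action_mul : ∀ (h : H) (x y : L),
    action h (x * y) =
      LinearMap.mul' K L
        (TensorProduct.map (action.toLinearMap.flip x) (action.toLinearMap.flip y)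
          (Coalgebra.comul (R := K) h))
  /-- `h · 1 = ε(h)`. -/
  action_one : ∀ h : H, action h 1 = algebraMap K L (Coalgebra.counit (R := K) h)
  /-- The canonical map `L ⊗[K] H → End_K(L)` is bijective. -/
  bijective : Function.Bijective
    (TensorProduct.lift
      ((LinearMap.mul K (Module.End K L)).compl₁₂
        (Algebra.lmul K L).toLinearMap action.toLinearMap))

section AssociatedOrder

variable (A : Type*) [CommRing A] {K L H : Type*} [Field K] [Field L] [Algebra K L] [Algebra A L]
  [Ring H] [Algebra K H]

/-- The associated order of `O_L` in `H`, where `O_L` is the integral closure of `A` in `L` and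
`H` acts on `L` through `ρ`: the set of `h` in `H` with `h · O_L ⊆ O_L`. -/
def associatedOrder (ρ : H →ₐ[K] Module.End K L) : Subring H where
  carrier := {h | ∀ x ∈ integralClosure A L, ρ h x ∈ integralClosure A L}
  mul_mem' {a b} ha hb x hx := by
    rw [map_mul, Module.End.mul_apply]
    exact ha _ (hb x hx)
  one_mem' x hx := by
    rw [map_one, Module.End.one_apply]
    exact hx
  add_mem' {a b} ha hb x hx := by
    rw [map_add, LinearMap.add_apply]
    exact add_mem (ha x hx) (hb x hx)
  zero_mem' x _ := by
    rw [map_zero, LinearMap.zero_apply]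
    exact zero_mem _
  neg_mem' {a} ha x hx := by
    rw [map_neg, LinearMap.neg_apply]
    exact neg_mem (ha x hx)

/-- `O_L` is a module over its associated order, through the action `ρ`. -/
instance associatedOrder.instModule (ρ : H →ₐ[K] Module.End K L) :
    Module (associatedOrder A ρ) (integralClosure A L) where
  smul h x := ⟨ρ h x, h.2 x x.2⟩
  one_smul x := Subtype.ext (by
    change ρ 1 (x : L) = x
    rw [map_one, Module.End.one_apply])
  mul_smul a b x := Subtype.ext (by
    change ρ ((a : H) * b) (x : L) = ρ a (ρ b x)
    rw [map_mul, Module.End.mul_apply])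
  smul_zero a := Subtype.ext (map_zero (ρ a))
  smul_add a x y := Subtype.ext (map_add (ρ a) (x : L) y)
  add_smul a b x := Subtype.ext (by
    change ρ ((a : H) + b) (x : L) = ρ a x + ρ b x
    rw [map_add, LinearMap.add_apply])
  zero_smul x := Subtype.ext (by
    change ρ 0 (x : L) = 0
    rw [map_zero, LinearMap.zero_apply])

/-- `O_L` is free over its associated order in `H`. -/
def IsFreeOverAssociatedOrder (ρ : H →ₐ[K] Module.End K L) : Prop :=
  Module.Free (associatedOrder A ρ) (integralClosure A L)

end AssociatedOrder

section Subfields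

variable {K N : Type*} [Field K] [Field N] [Algebra K N]

/-- Intermediate fields `E` and `F` of `N / K`, where `K` is the fraction field of `A`, are
arithmetically disjoint over `K` if they are linearly disjoint over `K` and
`O_{EF} = O_E O_F`, where `O` denotes integral closures of `A`. -/
structure ArithmeticallyDisjoint (A : Type*) [CommRing A] [Algebra A K] [Algebra A N]
    [IsScalarTower A K N] (E F : IntermediateField K N) : Prop where
  linearDisjoint : E.LinearDisjoint F
  integralClosure_sup :
    (integralClosure A (E ⊔ F : IntermediateField K N)).map
        ((E ⊔ F : IntermediateField K N).val.restrictScalars A) =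
      (integralClosure A E).map (E.val.restrictScalars A) ⊔
        (integralClosure A F).map (F.val.restrictScalars A)

/-- If `J ∩ G' = 1`, the fixed fields of `G'` and `J` generate `N`. -/
theorem fixedField_sup_fixedField_eq_top [FiniteDimensional K N]
    {J G' : Subgroup (N ≃ₐ[K] N)} (h : J.IsComplement' G') [IsGalois K N] :
    IntermediateField.fixedField G' ⊔ IntermediateField.fixedField J = ⊤ := by
  have h1 : (IntermediateField.fixedField G' ⊔ IntermediateField.fixedField J).fixingSubgroup
      = ⊥ := by
    rw [IntermediateField.fixingSubgroup_sup, IntermediateField.fixingSubgroup_fixedField,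
      IntermediateField.fixingSubgroup_fixedField, inf_comm, h.disjoint.eq_bot]
  rw [← IsGalois.fixedField_fixingSubgroup
    (IntermediateField.fixedField G' ⊔ IntermediateField.fixedField J), h1,
    IntermediateField.fixedField_bot]

/-- For linearly disjoint `E`, `F` with `EF = N`, the isomorphism `F ⊗[K] E ≃ N`,
`f ⊗ x ↦ f x`. -/
noncomputable def compositumEquiv {E F : IntermediateField K N} [FiniteDimensional K N]
    (hd : E.LinearDisjoint F) (htop : E ⊔ F = ⊤) : F ⊗[K] E ≃ₗ[F] N :=
  ((IntermediateField.linearDisjoint_iff'.1 hd.symm).mulMapLeftOfSupEqTop (by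
    rw [← IntermediateField.sup_toSubalgebra_of_left, sup_comm, htop,
      IntermediateField.top_toSubalgebra])).toLinearEquiv

/-- The action of `F ⊗[K] H` on `N = EF` deduced from an action `ρ` of `H` on `E`, for linearly
disjoint `E` and `F`: it is the base change of `ρ` from `K` to `F`, transported along
`F ⊗[K] E ≃ N`. -/
noncomputable def baseChangeAction {E F : IntermediateField K N} [FiniteDimensional K N]
    (hd : E.LinearDisjoint F) (htop : E ⊔ F = ⊤) {H : Type*} [Ring H] [Algebra K H]
    (ρ : H →ₐ[K] Module.End K E) : F ⊗[K] H →ₐ[F] Module.End F N :=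
  ((compositumEquiv hd htop).conjAlgEquiv F).toAlgHom.comp
    (Algebra.TensorProduct.lift (Algebra.ofId F (Module.End F (F ⊗[K] E)))
      ((Module.End.baseChangeHom K F E).comp ρ)
      (fun a _ => Algebra.commutes a _))

/-- The action is characterised by `(f ⊗ h) · (g x) = f g (h · x)` for `f, g ∈ F`, `x ∈ E`. -/
theorem baseChangeAction_tmul_mul {E F : IntermediateField K N} [FiniteDimensional K N]
    (hd : E.LinearDisjoint F) (htop : E ⊔ F = ⊤) {H : Type*} [Ring H] [Algebra K H]
    (ρ : H →ₐ[K] Module.End K E) (f g : F) (h : H) (x : E) :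
    baseChangeAction hd htop ρ (f ⊗ₜ h) ((g : N) * (x : N)) = (f : N) * g * (ρ h x : E) := by
  have key : (compositumEquiv hd htop) (g ⊗ₜ[K] x) = (g : N) * (x : N) := rfl
  rw [← key]
  change (compositumEquiv hd htop)
    ((algebraMap F (Module.End F (F ⊗[K] E)) f * Module.End.baseChangeHom K F E (ρ h))
      ((compositumEquiv hd htop).symm ((compositumEquiv hd htop) (g ⊗ₜ[K] x)))) = _
  rw [LinearEquiv.symm_apply_apply]
  change ((f * g : F) : N) * ((ρ h x : E) : N) = _
  rfl

end Subfields

/-!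
Everything rests on the decomposition of `N = EF` along `F`. Since `O_F` is a finite projective
`A`-module, it has a dual family: elements `f i` of `O_F` and linear forms `φ i` on `F`, integral on
`O_F`, with `∑ φ i (y) f i = y` (`IsDualFamily`, `exists_isDualFamily`). A form `φ` on `F` induces
coordinate maps `F ⊗ H → H` (`tensorCoord`) and `N → E` (`compositumCoord`), and these are
compatible with the actions: the coordinate of `t · x` is the coordinate of `t` applied to `x`, for
`x` in `E`. As `O_N = O_E O_F`, coordinates of integral elements are integral
(`ArithmeticallyDisjoint.compositumCoord_mem`), and hence the coordinates of an element of the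
associated order in `F ⊗ H` lie in the associated order in `H`. In other words both `O_N` and its
associated order are obtained from `O_E` and its associated order by applying `O_F ⊗ -`.

For the ascent, a basis of `O_E` over its associated order stays a basis after this base change
(`IsFreeOverAssociatedOrder.baseChange`).

For the descent over a semilocal base, `A` is a principal ideal domain, so `O_F` has an `A`-basis,
of size `d` say. Write `Λ` for the associated order of `O_E`. A comparison of dimensions shows that
`O_N` is free of rank one (`IsFreeOverAssociatedOrder.exists_bijective_smul`), and taking
coordinates gives an isomorphism `O_E ^ d ≅ Λ ^ d` of `Λ`-modules
(`nonempty_pi_linearEquiv_of_bijective_smul`). The exponent is removed modulo radicals: `Λ` is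
finite over the semilocal ring `A`, so `O_E / rad O_E` and `Λ / rad Λ` are semisimple of finite
length, and they contain each simple module with the same multiplicity. Nakayama's lemma then makes
`O_E` cyclic over `Λ` (`exists_span_singleton_eq_top_of_pi_linearEquiv`), and because
`dim H = dim E` a generator is a basis
(`isFreeOverAssociatedOrder_of_span_singleton_eq_top`).
-/

/-! ### Semisimple modules and multiplicities -/

section Semisimple

variable (A : Type*) [CommRing A] {Λ : Type*} [Ring Λ] [Algebra A Λ]

/-- A homomorphism out of a simple module is determined by its value at one nonzero vector, so
`Hom_Λ(X, M)` embeds `A`-linearly into `M`. -/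
theorem length_linearMap_le_of_isSimpleModule (X M : Type*)
    [AddCommGroup X] [Module Λ X] [IsSimpleModule Λ X]
    [AddCommGroup M] [Module Λ M] [Module A M] [IsScalarTower A Λ M] :
    Module.length A (X →ₗ[Λ] M) ≤ Module.length A M := by
  have : Nontrivial X := IsSimpleModule.nontrivial Λ X
  obtain ⟨x, hx⟩ := exists_ne (0 : X)
  refine Module.length_le_of_injective
    ({ toFun := fun f => f x, map_add' := fun _ _ => rfl, map_smul' := fun _ _ => rfl } :
      (X →ₗ[Λ] M) →ₗ[A] M) fun f g hfg => ?_
  have hspan := IsSimpleModule.span_singleton_eq_top Λ hx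
  refine LinearMap.ext_on_range (v := fun _ : Unit => x) ?_ fun _ => hfg
  simpa using hspan

/-- `Hom_Λ(X, -)` is additive in length. -/
theorem length_linearMap_of_linearEquiv_prod (X : Type*) {M M₁ M₂ : Type*}
    [AddCommGroup X] [Module Λ X]
    [AddCommGroup M] [Module Λ M] [Module A M] [IsScalarTower A Λ M]
    [AddCommGroup M₁] [Module Λ M₁] [Module A M₁] [IsScalarTower A Λ M₁]
    [AddCommGroup M₂] [Module Λ M₂] [Module A M₂] [IsScalarTower A Λ M₂]
    (e : M ≃ₗ[Λ] M₁ × M₂) :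
    Module.length A (X →ₗ[Λ] M) =
      Module.length A (X →ₗ[Λ] M₁) + Module.length A (X →ₗ[Λ] M₂) := by
  have e1 : (X →ₗ[Λ] M) ≃ₗ[A] (X →ₗ[Λ] M₁ × M₂) :=
    { toFun := fun f => e.toLinearMap ∘ₗ f
      invFun := fun f => e.symm.toLinearMap ∘ₗ f
      map_add' := fun f g => by ext <;> simp
      map_smul' := fun a f => LinearMap.ext fun x =>
        LinearMap.map_smul_of_tower e.toLinearMap a (f x)
      left_inv := fun f => by ext; simp
      right_inv := fun f => by ext <;> simp }
  rw [e1.length_eq, ← (LinearMap.prodEquiv A (R := Λ) (M := X)).length_eq, Module.length_prod]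

theorem length_linearMap_of_linearEquiv_pi (X : Type*) {M M₁ : Type*} {ι : Type*} [Fintype ι]
    [AddCommGroup X] [Module Λ X]
    [AddCommGroup M] [Module Λ M] [Module A M] [IsScalarTower A Λ M]
    [AddCommGroup M₁] [Module Λ M₁] [Module A M₁] [IsScalarTower A Λ M₁]
    (e : M ≃ₗ[Λ] (ι → M₁)) :
    Module.length A (X →ₗ[Λ] M) = Fintype.card ι * Module.length A (X →ₗ[Λ] M₁) := by
  have e1 : (X →ₗ[Λ] M) ≃ₗ[A] (ι → X →ₗ[Λ] M₁) :=
    { toFun := fun f i => LinearMap.proj i ∘ₗ e.toLinearMap ∘ₗ f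
      invFun := fun f => e.symm.toLinearMap ∘ₗ LinearMap.pi f
      map_add' := fun f g => by ext; simp
      map_smul' := fun a f => funext fun i => LinearMap.ext fun x =>
        congr_fun (LinearMap.map_smul_of_tower e.toLinearMap a (f x)) i
      left_inv := fun f => by
        ext x
        apply e.injective
        ext i
        simp
      right_inv := fun f => by ext; simp }
  rw [e1.length_eq, Module.length_pi]
  simp

/-- If every simple module occurs in the semisimple module `N` at least as often as in the
semisimple module `M` of finite length, then `M` is a quotient of `N`. Multiplicities are measured
by the `A`-length of `Hom_Λ(X, -)`. A simple submodule of `M` also embeds into `N`, and both copies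
split off. -/
theorem exists_surjective_of_length_linearMap_le.{u, v} (n : ℕ) (M : Type u) (N : Type v)
    [AddCommGroup M] [Module Λ M] [Module A M] [IsScalarTower A Λ M] [IsSemisimpleModule Λ M]
    [AddCommGroup N] [Module Λ N] [Module A N] [IsScalarTower A Λ N] [IsSemisimpleModule Λ N]
    (hn : Module.length A M ≤ n)
    (h : ∀ (X : Type u) [AddCommGroup X] [Module Λ X] [IsSimpleModule Λ X],
      Module.length A (X →ₗ[Λ] M) ≤ Module.length A (X →ₗ[Λ] N)) :
    ∃ f : N →ₗ[Λ] M, Function.Surjective f := by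
  induction n generalizing M N with
  | zero =>
    have : Subsingleton M := (Module.length_eq_zero_iff (R := A)).1 (by simpa using hn)
    exact ⟨0, fun x => ⟨0, Subsingleton.elim _ _⟩⟩
  | succ n ih =>
    rcases subsingleton_or_nontrivial M with hM | hM
    · exact ⟨0, fun x => ⟨0, Subsingleton.elim _ _⟩⟩
    obtain ⟨S, hS⟩ := IsSemisimpleModule.exists_simple_submodule Λ M
    obtain ⟨M', hM'⟩ := exists_isCompl S
    have : Nontrivial S := IsSimpleModule.nontrivial Λ S
    have hpos : 0 < Module.length A (S →ₗ[Λ] N) := by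
      refine lt_of_lt_of_le ?_ (h S)
      rw [Module.length_pos_iff]
      refine ⟨S.subtype, 0, fun h0 => ?_⟩
      obtain ⟨s, hs⟩ := exists_ne (0 : S)
      exact hs (Subtype.ext (by simpa using LinearMap.congr_fun h0 s))
    rw [Module.length_pos_iff] at hpos
    obtain ⟨g, hg⟩ := exists_ne (0 : S →ₗ[Λ] N)
    have hginj : Function.Injective g := (LinearMap.injective_or_eq_zero g).resolve_right hg
    obtain ⟨N', hN'⟩ := exists_isCompl (LinearMap.range g)
    let eS : S ≃ₗ[Λ] LinearMap.range g := LinearEquiv.ofInjective g hginj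
    let eM : M ≃ₗ[Λ] S × M' := (Submodule.prodEquivOfIsCompl S M' hM').symm
    let eN : N ≃ₗ[Λ] S × N' := (Submodule.prodEquivOfIsCompl _ N' hN').symm ≪≫ₗ
      LinearEquiv.prodCongr eS.symm (LinearEquiv.refl Λ N')
    have hlen : Module.length A M = Module.length A S + Module.length A M' := by
      rw [← Module.length_prod]
      exact (eM.restrictScalars A).length_eq
    have hMtop : Module.length A M ≠ ⊤ := ne_top_of_le_ne_top (by simp) hn
    have hStop : Module.length A S ≠ ⊤ := by
      intro hh; rw [hh] at hlen; simp [hlen] at hMtop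
    obtain ⟨f, hf⟩ := ih M' N' (by
        have h1 : 1 ≤ Module.length A S := Order.one_le_iff_pos.2 Module.length_pos
        have h2 : 1 + Module.length A M' ≤ 1 + (n : ℕ∞) := by
          calc 1 + Module.length A M' ≤ Module.length A S + Module.length A M' := by gcongr
            _ ≤ _ := by rw [← hlen, add_comm]; exact_mod_cast hn
        exact (ENat.add_le_add_iff_left (by simp)).1 h2)
      (fun X _ _ _ => by
        have h1 := h X
        rw [length_linearMap_of_linearEquiv_prod A X eM,
          length_linearMap_of_linearEquiv_prod A X eN] at h1
        exact (ENat.add_le_add_iff_left (ne_top_of_le_ne_top hStop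
          (length_linearMap_le_of_isSimpleModule A X S))).1 h1)
    refine ⟨eM.symm.toLinearMap ∘ₗ LinearMap.prodMap LinearMap.id f ∘ₗ eN.toLinearMap, ?_⟩
    have : Function.Surjective (LinearMap.prodMap (LinearMap.id : S →ₗ[Λ] S) f) :=
      Function.surjective_id.prodMap hf
    exact eM.symm.surjective.comp (this.comp eN.surjective)

end Semisimple

/-! ### Finite modules over algebras over a semilocal ring -/

section Semilocal

variable (A : Type*) [CommRing A] {Λ : Type*} [Ring Λ] [Algebra A Λ]

/-- The quotient embeds into the finite product of the residue fields of `A`. -/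
theorem isArtinianRing_quotient_jacobson_bot [Finite (MaximalSpectrum A)] :
    IsArtinianRing (A ⧸ Ideal.jacobson (⊥ : Ideal A)) := by
  have hs : ∀ m : MaximalSpectrum A, IsArtinian A (A ⧸ m.asIdeal) := fun m => by
    have := (isSimpleModule_iff_isCoatom (R := A) (m := m.asIdeal)).2
      (Ideal.isMaximal_def.1 m.isMaximal)
    infer_instance
  let f : A →ₗ[A] (m : MaximalSpectrum A) → A ⧸ m.asIdeal :=
    LinearMap.pi fun m => m.asIdeal.mkQ
  have hker : LinearMap.ker f = Ideal.jacobson (⊥ : Ideal A) := by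
    ext x
    simp only [f, LinearMap.mem_ker, Ideal.jacobson, Ideal.mem_sInf, Set.mem_ofPred_eq]
    constructor
    · rintro h I ⟨-, hI⟩
      exact (Submodule.Quotient.mk_eq_zero _).1 (congr_fun h ⟨I, hI⟩)
    · intro h
      funext m
      exact (Submodule.Quotient.mk_eq_zero _).2 (h ⟨bot_le, m.isMaximal⟩)
  have : IsArtinian A (A ⧸ LinearMap.ker f) :=
    isArtinian_of_injective _ (LinearMap.ker_eq_bot.1 (Submodule.ker_liftQ_eq_bot' _ f rfl))
  rw [hker] at this
  exact isArtinian_of_tower A this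

variable (M : Type*) [AddCommGroup M] [Module Λ M] [Module A M] [IsScalarTower A Λ M]

/-- The Jacobson radical of `A` kills every simple `Λ`-module that is finite over `A`, by
Nakayama's lemma. -/
theorem smul_mem_jacobson_of_mem_jacobson [Module.Finite A M] {a : A}
    (ha : a ∈ Ideal.jacobson (⊥ : Ideal A)) (x : M) : a • x ∈ Module.jacobson Λ M := by
  rw [Module.jacobson, Submodule.mem_sInf]
  intro P hP
  by_contra hx
  -- `a • M + P` is a `Λ`-submodule that properly contains `P`, hence it is `M`.
  let aM : Submodule Λ M := LinearMap.range
    ({ toFun := fun y => a • y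
       map_add' := smul_add a
       map_smul' := fun l y => smul_comm a l y } : M →ₗ[Λ] M)
  have hsup : aM ⊔ P = ⊤ := by
    refine hP.2 _ (lt_of_le_of_ne le_sup_right fun he => hx ?_)
    rw [he]
    exact Submodule.mem_sup_left ⟨x, rfl⟩
  have hle : (⊤ : Submodule A M) ≤ P.restrictScalars A := by
    refine Submodule.le_of_le_smul_of_le_jacobson_bot (I := Ideal.jacobson ⊥)
      Module.Finite.fg_top le_rfl ?_
    intro y _
    have hy : y ∈ aM ⊔ P := hsup ▸ Submodule.mem_top
    obtain ⟨u, ⟨z, rfl⟩, v, hv, rfl⟩ := Submodule.mem_sup.1 hy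
    exact Submodule.add_mem _ (Submodule.mem_sup_right
      (Submodule.smul_mem_smul ha Submodule.mem_top)) (Submodule.mem_sup_left hv)
  exact hP.1 (top_le_iff.1 fun y _ => hle (Submodule.mem_top (x := y)))

theorem isArtinian_of_isTorsionBySet_jacobson_bot [Finite (MaximalSpectrum A)]
    (Q : Type*) [AddCommGroup Q] [Module A Q] [Module.Finite A Q]
    (h : Module.IsTorsionBySet A Q (Ideal.jacobson (⊥ : Ideal A))) : IsArtinian A Q := by
  let _ := h.module
  have : IsScalarTower A (A ⧸ Ideal.jacobson (⊥ : Ideal A)) Q := h.isScalarTower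
  have := isArtinianRing_quotient_jacobson_bot A
  have : Module.Finite (A ⧸ Ideal.jacobson (⊥ : Ideal A)) Q :=
    Module.Finite.of_restrictScalars_finite A _ _
  exact isArtinian_of_surjective_algebraMap (R := A ⧸ Ideal.jacobson (⊥ : Ideal A))
    Ideal.Quotient.mk_surjective

instance finite_quotient_jacobson [Module.Finite A M] :
    Module.Finite A (M ⧸ Module.jacobson Λ M) :=
  Module.Finite.of_surjective ((Module.jacobson Λ M).mkQ.restrictScalars A)
    (Submodule.mkQ_surjective (Module.jacobson Λ M))

theorem isArtinian_quotient_jacobson [Finite (MaximalSpectrum A)] [Module.Finite A M] :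
    IsArtinian A (M ⧸ Module.jacobson Λ M) := by
  have h (x : M ⧸ Module.jacobson Λ M) (a : (Ideal.jacobson (⊥ : Ideal A) : Set A)) :
      (a : A) • x = 0 := by
    obtain ⟨x, rfl⟩ := Submodule.Quotient.mk_surjective _ x
    exact (Submodule.Quotient.mk_eq_zero _).2 (smul_mem_jacobson_of_mem_jacobson A M a.2 x)
  exact isArtinian_of_isTorsionBySet_jacobson_bot A _ fun x a => h x a

theorem isSemisimpleModule_quotient_jacobson [Finite (MaximalSpectrum A)] [Module.Finite A M] :
    IsSemisimpleModule Λ (M ⧸ Module.jacobson Λ M) := by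
  have : IsArtinian Λ (M ⧸ Module.jacobson Λ M) :=
    isArtinian_of_tower A (isArtinian_quotient_jacobson A M)
  exact (IsArtinian.isSemisimpleModule_iff_jacobson _ _).2 (Module.jacobson_quotient_jacobson Λ M)

theorem jacobson_pi_const (ι : Type*) [Fintype ι] :
    Module.jacobson Λ (ι → M) = Submodule.pi Set.univ fun _ => Module.jacobson Λ M := by
  classical
  refine le_antisymm (Module.jacobson_pi_le _ _) fun x hx => ?_
  rw [← Finset.univ_sum_single x]
  exact Submodule.sum_mem _ fun i _ => Module.map_jacobson_le (LinearMap.single Λ (fun _ => M) i)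
    ⟨x i, hx i trivial, rfl⟩

/-- Quotients by the radical commute with finite powers. -/
noncomputable def quotientJacobsonPiEquiv (ι : Type*) [Fintype ι] :
    ((ι → M) ⧸ Module.jacobson Λ (ι → M)) ≃ₗ[Λ] (ι → M ⧸ Module.jacobson Λ M) :=
  let f : (ι → M) →ₗ[Λ] (ι → M ⧸ Module.jacobson Λ M) :=
    LinearMap.pi fun i => (Module.jacobson Λ M).mkQ ∘ₗ LinearMap.proj i
  have hker : Module.jacobson Λ (ι → M) = LinearMap.ker f := by
    rw [jacobson_pi_const]
    ext x
    simp [f, funext_iff]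
  have hf : Function.Surjective f := fun y =>
    ⟨fun i => (y i).out, funext fun i => Quotient.out_eq (y i)⟩
  Submodule.quotEquivOfEq _ _ hker ≪≫ₗ f.quotKerEquivOfSurjective hf

/-- Over a finite algebra `Λ` over a semilocal ring, a finite module `M` with `Mᵈ ≅ Λᵈ` is cyclic:
modulo radicals both sides become semisimple of finite length, so the multiplicities of the simple
modules in `M / rad M` and `Λ / rad Λ` agree, and a generator lifts by Nakayama's lemma. -/
theorem exists_span_singleton_eq_top_of_pi_linearEquiv [IsNoetherianRing A]
    [Finite (MaximalSpectrum A)] [Module.Finite A Λ] [Module.Finite A M]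
    (ι : Type*) [Fintype ι] [Nonempty ι]
    (e : (ι → M) ≃ₗ[Λ] (ι → Λ)) : ∃ m : M, Submodule.span Λ {m} = ⊤ := by
  classical
  have hM := isSemisimpleModule_quotient_jacobson A (Λ := Λ) M
  have hΛ := isSemisimpleModule_quotient_jacobson A (Λ := Λ) Λ
  have hart := isArtinian_quotient_jacobson A (Λ := Λ) M
  have hlen : Module.length A (M ⧸ Module.jacobson Λ M) ≠ ⊤ := Module.length_ne_top
  obtain ⟨n, hn⟩ := ENat.ne_top_iff_exists.1 hlen
  -- the isomorphism induced modulo radicals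
  let e' : (ι → M ⧸ Module.jacobson Λ M) ≃ₗ[Λ] (ι → Λ ⧸ Module.jacobson Λ Λ) :=
    (quotientJacobsonPiEquiv M ι).symm ≪≫ₗ Submodule.Quotient.equiv _ _ e
      (Module.map_jacobson_of_bijective (f := e.toLinearMap) e.bijective) ≪≫ₗ
      quotientJacobsonPiEquiv Λ ι
  obtain ⟨f, hf⟩ := exists_surjective_of_length_linearMap_le A (Λ := Λ) n
      (M ⧸ Module.jacobson Λ M) (Λ ⧸ Module.jacobson Λ Λ) hn.ge fun X _ _ _ => by
    have h1 := length_linearMap_of_linearEquiv_pi A X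
      (LinearEquiv.refl Λ (ι → M ⧸ Module.jacobson Λ M))
    rw [length_linearMap_of_linearEquiv_pi A X e'] at h1
    have h2 : (Fintype.card ι : ℕ∞) ≠ 0 := by simp
    exact (ENat.mul_le_mul_left_iff h2 (by simp)).1 h1.ge
  let g : Λ →ₗ[Λ] M ⧸ Module.jacobson Λ M := f ∘ₗ (Module.jacobson Λ Λ).mkQ
  have hg : Function.Surjective g := hf.comp (Submodule.mkQ_surjective _)
  obtain ⟨m, hm⟩ := Submodule.mkQ_surjective _ (g 1)
  refine ⟨m, ?_⟩
  have : Module.Finite Λ M := Module.Finite.of_restrictScalars_finite A Λ M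
  refine (eq_top_or_exists_le_coatom (Submodule.span Λ {m})).resolve_right ?_
  rintro ⟨P, hP, hmP⟩
  refine hP.1 (top_le_iff.1 fun x _ => ?_)
  obtain ⟨l, hl⟩ := hg (Submodule.Quotient.mk x)
  have hx : x - l • m ∈ Module.jacobson Λ M := by
    rw [← Submodule.Quotient.mk_eq_zero, Submodule.Quotient.mk_sub, Submodule.Quotient.mk_smul,
      ← Submodule.mkQ_apply _ m, hm, ← map_smul, smul_eq_mul, mul_one, hl, sub_self]
  have hxP : x - l • m ∈ P := Submodule.mem_sInf.1 hx P hP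
  simpa using P.add_mem hxP (P.smul_mem l (hmP (Submodule.mem_span_singleton_self m)))

end Semilocal

/-! ### Associated orders -/

section AssociatedOrderBasic

variable (A : Type*) [CommRing A] {K L H : Type*} [Field K] [Field L] [Algebra K L]
  [Algebra A K] [Algebra A L] [IsScalarTower A K L] [Ring H] [Algebra K H]

/-- `A` acts on the associated order by scalars. -/
@[reducible] def associatedOrder.algebra (ρ : H →ₐ[K] Module.End K L) :
    Algebra A (associatedOrder A ρ) :=
  RingHom.toAlgebra'
    (((algebraMap K H).comp (algebraMap A K)).codRestrict (associatedOrder A ρ) fun a x hx => by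
      have h : ρ (algebraMap K H (algebraMap A K a)) x = a • x := by
        rw [AlgHom.commutes, Module.algebraMap_end_apply, algebraMap_smul]
      rw [RingHom.comp_apply, h]
      exact Subalgebra.smul_mem _ hx a)
    fun a x => Subtype.ext (Algebra.commutes (algebraMap A K a) (x : H))

theorem exists_smul_mem_integralClosure [Algebra.IsAlgebraic A L] (y : L) :
    ∃ a : A, a ≠ 0 ∧ algebraMap A K a • y ∈ integralClosure A L := by
  obtain ⟨a, ha, hy⟩ := (Algebra.IsAlgebraic.isAlgebraic (R := A) y).exists_integral_multiple
  exact ⟨a, ha, by rwa [algebraMap_smul]⟩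

/-- The integral closure spans the field, so an operator is determined by its restriction to it. -/
theorem eq_zero_of_forall_integralClosure [Algebra.IsAlgebraic A L]
    (hA : Function.Injective (algebraMap A K)) {f : Module.End K L}
    (hf : ∀ x ∈ integralClosure A L, f x = 0) : f = 0 := by
  ext y
  obtain ⟨a, ha, hy⟩ := exists_smul_mem_integralClosure A (K := K) y
  have := hf _ hy
  rw [map_smul] at this
  exact (smul_eq_zero.1 this).resolve_left fun h => ha (hA (by rw [h, map_zero]))

/-- Every element of `H` has a nonzero multiple in the associated order. -/
theorem exists_smul_mem_associatedOrder [IsDomain A] [Algebra.IsAlgebraic A L]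
    [Module.Finite A (integralClosure A L)] (ρ : H →ₐ[K] Module.End K L) (h : H) :
    ∃ a : A, a ≠ 0 ∧ algebraMap A K a • h ∈ associatedOrder A ρ := by
  classical
  obtain ⟨s, hs⟩ := Module.Finite.fg_top (R := A) (M := integralClosure A L)
  choose c hc0 hc using fun y : L => exists_smul_mem_integralClosure A (K := K) y
  refine ⟨∏ x ∈ s, c (ρ h x), Finset.prod_ne_zero_iff.2 fun x _ => hc0 _, fun x hx => ?_⟩
  have hmem : (⟨x, hx⟩ : integralClosure A L) ∈ Submodule.span A (s : Set (integralClosure A L)) :=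
    hs ▸ Submodule.mem_top
  let g : L →ₗ[A] L := (ρ (algebraMap A K (∏ x ∈ s, c (ρ h x)) • h)).restrictScalars A
  have hle : Submodule.span A (s : Set (integralClosure A L)) ≤
      (Subalgebra.toSubmodule (integralClosure A L)).comap
        (g ∘ₗ (integralClosure A L).val.toLinearMap) := by
    refine Submodule.span_le.2 fun y hy => ?_
    change ρ (algebraMap A K (∏ x ∈ s, c (ρ h x)) • h) (y : L) ∈ integralClosure A L
    rw [← Finset.prod_erase_mul s _ hy, map_mul, mul_smul, map_smul, map_smul,
      LinearMap.smul_apply, LinearMap.smul_apply, algebraMap_smul]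
    exact Subalgebra.smul_mem _ (hc _) _
  exact hle hmem

/-- If `O_L` is cyclic over its associated order and `dim H = dim L`, then it is free: the orbit map
of a generator extends to a surjection, hence a bijection, from `H` to `L`. -/
theorem isFreeOverAssociatedOrder_of_span_singleton_eq_top [Algebra.IsAlgebraic A L]
    (hA : Function.Injective (algebraMap A K)) [FiniteDimensional K H] [FiniteDimensional K L]
    (hdim : Module.finrank K H = Module.finrank K L) (ρ : H →ₐ[K] Module.End K L)
    (m : integralClosure A L) (hm : Submodule.span (associatedOrder A ρ) {m} = ⊤) :
    IsFreeOverAssociatedOrder A ρ := by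
  let g : H →ₗ[K] L := ρ.toLinearMap.flip (m : L)
  have hsurj : Function.Surjective g := fun y => by
    obtain ⟨a, ha, hy⟩ := exists_smul_mem_integralClosure A (K := K) y
    obtain ⟨t, ht⟩ := Submodule.mem_span_singleton.1
      (hm ▸ Submodule.mem_top : (⟨_, hy⟩ : integralClosure A L) ∈
        Submodule.span (associatedOrder A ρ) {m})
    have ht' : g t = algebraMap A K a • y := congrArg Subtype.val ht
    refine ⟨(algebraMap A K a)⁻¹ • (t : H), ?_⟩
    rw [map_smul, ht', inv_smul_smul₀ ((map_ne_zero_iff _ hA).2 ha)]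
  have hinj : Function.Injective g :=
    (LinearMap.injective_iff_surjective_of_finrank_eq_finrank hdim).2 hsurj
  let e : associatedOrder A ρ ≃ₗ[associatedOrder A ρ] integralClosure A L :=
    LinearEquiv.ofBijective (LinearMap.toSpanSingleton (associatedOrder A ρ) _ m)
      ⟨fun t u htu => Subtype.ext (hinj (congrArg Subtype.val htu)), fun x =>
        Submodule.mem_span_singleton.1 (hm ▸ Submodule.mem_top)⟩
  exact Module.Free.of_equiv e

/-- If `O_L` is free over its associated order and `dim H = dim L`, then it is free of rank one:
one basis vector `b` already generates `L` over `H`, and another one would be linearly dependent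
on `b` over the associated order, after clearing denominators. -/
theorem IsFreeOverAssociatedOrder.exists_bijective_smul [IsDomain A]
    [Algebra.IsAlgebraic A L]
    (hA : Function.Injective (algebraMap A K)) [FiniteDimensional K H] [FiniteDimensional K L]
    [Module.Finite A (integralClosure A L)]
    (hdim : Module.finrank K H = Module.finrank K L) {ρ : H →ₐ[K] Module.End K L}
    (hfree : IsFreeOverAssociatedOrder A ρ) :
    ∃ b : integralClosure A L, Function.Bijective fun t : associatedOrder A ρ => t • b := by
  have hA0 {a : A} (ha : a ≠ 0) : algebraMap A K a ≠ 0 := (map_ne_zero_iff _ hA).2 ha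
  have : Nontrivial H := Module.nontrivial_of_finrank_pos (R := K) (hdim ▸ Module.finrank_pos)
  obtain ⟨⟨I, b⟩⟩ := hfree.exists_basis
  have hI : Nonempty I := by
    by_contra h
    rw [not_nonempty_iff] at h
    have := b.repr.injective (Subsingleton.elim (b.repr 0) (b.repr 1))
    exact zero_ne_one this
  obtain ⟨i⟩ := hI
  let g : H →ₗ[K] L := ρ.toLinearMap.flip (b i : L)
  have hinj : Function.Injective g := by
    refine (injective_iff_map_eq_zero g).2 fun t ht => ?_
    obtain ⟨a, ha, hat⟩ := exists_smul_mem_associatedOrder A ρ t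
    have h0 : (⟨_, hat⟩ : associatedOrder A ρ) • b i = 0 := Subtype.ext (by
      change g (algebraMap A K a • t) = 0
      rw [map_smul, ht, smul_zero])
    have h1 := congrArg (fun x => b.repr x i) h0
    simp only [map_smul, Module.Basis.repr_self, Finsupp.smul_single, smul_eq_mul, mul_one,
      Finsupp.single_eq_same, map_zero, Finsupp.coe_zero, Pi.zero_apply] at h1
    exact (smul_eq_zero.1 (congrArg Subtype.val h1)).resolve_left (hA0 ha)
  have hsurj : Function.Surjective g :=
    (LinearMap.injective_iff_surjective_of_finrank_eq_finrank hdim).1 hinj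
  have hone (a : A) : algebraMap A K a • (1 : H) ∈ associatedOrder A ρ := fun x hx => by
    rw [map_smul, map_one, LinearMap.smul_apply, Module.End.one_apply, algebraMap_smul]
    exact Subalgebra.smul_mem _ hx a
  have hsub : ∀ j, j = i := fun j => by
    by_contra hji
    obtain ⟨t, ht⟩ := hsurj (b j)
    obtain ⟨a, ha, hat⟩ := exists_smul_mem_associatedOrder A ρ t
    have h0 : (⟨_, hat⟩ : associatedOrder A ρ) • b i = (⟨_, hone a⟩ : associatedOrder A ρ) • b j :=
      Subtype.ext (by
        change g (algebraMap A K a • t) = ρ (algebraMap A K a • 1) (b j : L)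
        rw [map_smul, ht, map_smul, map_one, LinearMap.smul_apply, Module.End.one_apply])
    have h1 := congrArg (fun x => b.repr x j) h0
    simp only [map_smul, Module.Basis.repr_self, Finsupp.smul_single, smul_eq_mul, mul_one,
      Finsupp.single_eq_same, Finsupp.single_eq_of_ne hji] at h1
    exact hA0 ha ((smul_eq_zero.1 (congrArg Subtype.val h1).symm).resolve_right one_ne_zero)
  refine ⟨b i, fun t u htu => Subtype.ext (hinj (congrArg Subtype.val htu)), fun x => ?_⟩
  let _ : Unique I := ⟨⟨i⟩, hsub⟩
  refine ⟨b.repr x i, ?_⟩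
  have := b.sum_repr x
  rwa [Fintype.sum_unique] at this

/-- Over a semilocal principal ideal domain, `O_L` is cyclic over its associated order as soon as
some power of it is a free module of the expected rank. -/
theorem associatedOrder.exists_span_singleton_eq_top [Algebra.IsAlgebraic A L]
    (hA : Function.Injective (algebraMap A K)) [IsNoetherianRing A] [Finite (MaximalSpectrum A)]
    [Module.Finite A (integralClosure A L)] [Module.Free A (integralClosure A L)]
    {ρ : H →ₐ[K] Module.End K L} (hρ : Function.Injective ρ)
    (ι : Type*) [Fintype ι] [Nonempty ι]
    (e : (ι → integralClosure A L) ≃ₗ[associatedOrder A ρ] (ι → associatedOrder A ρ)) :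
    ∃ m : integralClosure A L, Submodule.span (associatedOrder A ρ) {m} = ⊤ := by
  let _ := associatedOrder.algebra A ρ
  have hsmul (a : A) (x : L) : ρ (algebraMap K H (algebraMap A K a)) x = a • x := by
    rw [AlgHom.commutes, Module.algebraMap_end_apply, algebraMap_smul]
  have : IsScalarTower A (associatedOrder A ρ) (integralClosure A L) :=
    ⟨fun a t x => Subtype.ext (by
      change ρ ((algebraMap K H (algebraMap A K a)) * t) (x : L) = a • ρ t x
      rw [map_mul, Module.End.mul_apply, hsmul])⟩
  have hinj : Function.Injective (Algebra.lsmul A (A := associatedOrder A ρ) A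
      (integralClosure A L)) := by
    refine (injective_iff_map_eq_zero _).2 fun t ht => Subtype.ext (hρ ?_)
    rw [Subring.coe_zero, map_zero]
    refine eq_zero_of_forall_integralClosure A hA fun x hx => ?_
    exact congrArg Subtype.val (LinearMap.congr_fun ht (⟨x, hx⟩ : integralClosure A L))
  have : Module.Finite A (associatedOrder A ρ) :=
    Module.Finite.of_injective (Algebra.lsmul A (A := associatedOrder A ρ) A
      (integralClosure A L)).toLinearMap hinj
  exact exists_span_singleton_eq_top_of_pi_linearEquiv A _ ι e

end AssociatedOrderBasic

/-! ### Dual bases of rings of integers -/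

section DualBasis

theorem exists_dual_family_of_projective (A P : Type*) [CommRing A] [AddCommGroup P] [Module A P]
    [Module.Finite A P] [Module.Projective A P] :
    ∃ (n : ℕ) (f : Fin n → P) (ψ : Fin n → P →ₗ[A] A), ∀ y, ∑ i, ψ i y • f i = y := by
  obtain ⟨n, p, hp⟩ := Module.Finite.exists_fin' A P
  obtain ⟨s, hs⟩ := Module.projective_lifting_property p LinearMap.id hp
  refine ⟨n, fun i => p (Pi.single i 1), fun i => LinearMap.proj i ∘ₗ s, fun y => ?_⟩
  have h1 : p (s y) = y := LinearMap.congr_fun hs y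
  conv_rhs => rw [← h1, pi_eq_sum_univ' (s y), map_sum]
  refine Finset.sum_congr rfl fun i _ => ?_
  rw [← map_smul]
  congr 1

variable {A : Type*} (K : Type*) {F : Type*} [CommRing A] [IsDomain A] [Field K] [Algebra A K]
  [IsFractionRing A K] [Field F] [Algebra K F] [Algebra A F] [IsScalarTower A K F]

theorem exists_linearMap_extending [Algebra.IsAlgebraic A F]
    (ψ : integralClosure A F →ₗ[A] A) :
    ∃ φ : F →ₗ[K] K, ∀ f : integralClosure A F, φ f = algebraMap A K (ψ f) := by
  have hinj : Function.Injective (algebraMap A F) := by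
    rw [IsScalarTower.algebraMap_eq A K F]
    exact (algebraMap K F).injective.comp (IsFractionRing.injective A K)
  have : FaithfulSMul A (integralClosure A F) := by
    rw [faithfulSMul_iff_algebraMap_injective]
    exact fun x y hxy => hinj (congrArg Subtype.val hxy)
  have : IsFractionRing (integralClosure A F) F :=
    integralClosure.isFractionRing_of_algebraic fun x hx =>
      (map_eq_zero_iff _ hinj).1 hx
  have hb :=
    Algebra.IsAlgebraic.isBaseChange_of_isFractionRing A (integralClosure A F) K F
  exact ⟨hb.lift (Algebra.linearMap A K ∘ₗ ψ), fun f => hb.lift_eq _ f⟩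

/-- A dual family for the `A`-module `O_F` extends to a dual family for the `K`-vector
space `F`. -/
theorem exists_dual_family_extending [Algebra.IsAlgebraic A F] {ι : Type*} [Fintype ι]
    (f : ι → integralClosure A F) (ψ : ι → integralClosure A F →ₗ[A] A)
    (h : ∀ y, ∑ i, ψ i y • f i = y) :
    ∃ φ : ι → F →ₗ[K] K, (∀ i (y : integralClosure A F), φ i y = algebraMap A K (ψ i y)) ∧
      ∀ y : F, ∑ i, φ i y • (f i : F) = y := by
  choose φ hφ using fun i => exists_linearMap_extending K (ψ i)
  refine ⟨φ, hφ, fun y => ?_⟩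
  obtain ⟨a, ha, hy⟩ := exists_smul_mem_integralClosure A (K := K) y
  have ha' : algebraMap A K a ≠ 0 := (map_ne_zero_iff _ (IsFractionRing.injective A K)).2 ha
  have h1 := congrArg Subtype.val (h ⟨_, hy⟩)
  have h2 : ∑ i, φ i (algebraMap A K a • y) • (f i : F) = algebraMap A K a • y := by
    refine Eq.trans ?_ h1
    rw [AddSubmonoidClass.coe_finsetSum]
    refine Finset.sum_congr rfl fun i _ => ?_
    rw [hφ i ⟨_, hy⟩, algebraMap_smul]
    rfl
  simp only [map_smul, smul_assoc, ← Finset.smul_sum] at h2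
  exact smul_right_injective F ha' h2

end DualBasis

/-! ### Coordinates on the compositum -/

section Coordinates

variable {K N : Type*} [Field K] [Field N] [Algebra K N] {E F : IntermediateField K N}

/-- The linear map `F ⊗ V → V`, `f ⊗ v ↦ φ(f) v`, given by a linear form `φ` on `F`. -/
noncomputable def tensorCoord (φ : F →ₗ[K] K) (V : Type*) [AddCommGroup V] [Module K V] :
    F ⊗[K] V →ₗ[K] V :=
  (TensorProduct.lid K V).toLinearMap ∘ₗ φ.rTensor V

theorem tensorCoord_tmul (φ : F →ₗ[K] K) {V : Type*} [AddCommGroup V] [Module K V]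
    (f : F) (v : V) : tensorCoord φ V (f ⊗ₜ v) = φ f • v := by
  simp [tensorCoord]

theorem sum_tmul_tensorCoord {ι : Type*} [Fintype ι] {f : ι → F} {φ : ι → F →ₗ[K] K}
    (h : ∀ y, ∑ i, φ i y • f i = y) {V : Type*} [AddCommGroup V] [Module K V] (t : F ⊗[K] V) :
    ∑ i, f i ⊗ₜ[K] tensorCoord (φ i) V t = t := by
  induction t with
  | zero => simp
  | add x y hx hy => simp only [map_add, TensorProduct.tmul_add, Finset.sum_add_distrib, hx, hy]
  | tmul y v =>
    simp only [tensorCoord_tmul, ← TensorProduct.smul_tmul, ← TensorProduct.sum_tmul, h]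

variable [FiniteDimensional K N] (hd : E.LinearDisjoint F) (htop : E ⊔ F = ⊤)

theorem compositumEquiv_tmul (f : F) (x : E) :
    compositumEquiv hd htop (f ⊗ₜ x) = (f : N) * (x : N) :=
  rfl

/-- The linear map `N = EF → E`, `f x ↦ φ(f) x`, given by a linear form `φ` on `F`. -/
noncomputable def compositumCoord (φ : F →ₗ[K] K) : N →ₗ[K] E :=
  tensorCoord φ E ∘ₗ ((compositumEquiv hd htop).symm.toLinearMap.restrictScalars K)

theorem compositumCoord_compositumEquiv (φ : F →ₗ[K] K) (w : F ⊗[K] E) :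
    compositumCoord hd htop φ (compositumEquiv hd htop w) = tensorCoord φ E w :=
  congrArg (tensorCoord φ E) ((compositumEquiv hd htop).symm_apply_apply w)

theorem compositumCoord_mul (φ : F →ₗ[K] K) (f : F) (x : E) :
    compositumCoord hd htop φ ((f : N) * (x : N)) = φ f • x := by
  rw [← compositumEquiv_tmul hd htop, compositumCoord_compositumEquiv, tensorCoord_tmul]

theorem sum_mul_compositumCoord {ι : Type*} [Fintype ι] {f : ι → F} {φ : ι → F →ₗ[K] K}
    (h : ∀ y, ∑ i, φ i y • f i = y) (z : N) :
    ∑ i, (f i : N) * (compositumCoord hd htop (φ i) z : N) = z := by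
  obtain ⟨w, rfl⟩ := (compositumEquiv hd htop).surjective z
  simp only [compositumCoord_compositumEquiv]
  conv_rhs => rw [← sum_tmul_tensorCoord h w, map_sum]
  rfl

variable {H : Type*} [Ring H] [Algebra K H] (ρ : H →ₐ[K] Module.End K E)

theorem baseChangeAction_tmul_coe (f : F) (h : H) (x : E) :
    baseChangeAction hd htop ρ (f ⊗ₜ h) (x : N) = (f : N) * (ρ h x : E) := by
  simpa using baseChangeAction_tmul_mul hd htop ρ f 1 h x

theorem compositumCoord_baseChangeAction_coe (φ : F →ₗ[K] K) (t : F ⊗[K] H) (x : E) :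
    compositumCoord hd htop φ (baseChangeAction hd htop ρ t (x : N)) =
      ρ (tensorCoord φ H t) x := by
  induction t with
  | zero => simp
  | add t u ht hu => simp only [map_add, LinearMap.add_apply, ht, hu]
  | tmul f h =>
    rw [baseChangeAction_tmul_coe, compositumCoord_mul, tensorCoord_tmul, map_smul,
      LinearMap.smul_apply]

theorem compositumCoord_baseChangeAction_one_tmul (φ : F →ₗ[K] K) (h : H) (z : N) :
    compositumCoord hd htop φ (baseChangeAction hd htop ρ (1 ⊗ₜ h) z) =
      ρ h (compositumCoord hd htop φ z) := by
  obtain ⟨w, rfl⟩ := (compositumEquiv hd htop).surjective z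
  induction w with
  | zero => simp
  | add t u ht hu => simp only [map_add, ht, hu]
  | tmul g x =>
    rw [compositumEquiv_tmul, baseChangeAction_tmul_mul, compositumCoord_mul,
      IntermediateField.coe_one, one_mul, compositumCoord_mul, map_smul]

end Coordinates

section Integrality

variable {A K N : Type*} [CommRing A] [Field K] [Algebra A K] [Field N] [Algebra K N]
  [Algebra A N] [IsScalarTower A K N] {E F : IntermediateField K N}

theorem coe_mem_integralClosure {E : IntermediateField K N} {x : E} :
    (x : N) ∈ integralClosure A N ↔ x ∈ integralClosure A E :=
  isIntegral_algHom_iff (E.val.restrictScalars A) E.val.injective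

/-- If `O_N = O_E O_F`, then a linear form on `F` that is integral on `O_F` induces a map
`N → E` that is integral on `O_N`. -/
theorem ArithmeticallyDisjoint.compositumCoord_mem [FiniteDimensional K N]
    (hd : ArithmeticallyDisjoint A E F)
    (htop : E ⊔ F = ⊤) {φ : F →ₗ[K] K}
    (hφ : ∀ y : integralClosure A F, ∃ a : A, φ y = algebraMap A K a) {z : N}
    (hz : z ∈ integralClosure A N) :
    compositumCoord hd.linearDisjoint htop φ z ∈ integralClosure A E := by
  have hz' : z ∈ (integralClosure A E).map (E.val.restrictScalars A) ⊔
      (integralClosure A F).map (F.val.restrictScalars A) := by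
    rw [← hd.integralClosure_sup]
    exact ⟨⟨z, htop ▸ IntermediateField.mem_top⟩, coe_mem_integralClosure.1 hz, rfl⟩
  rw [← Subalgebra.mem_toSubmodule, ← Subalgebra.mul_toSubmodule] at hz'
  clear hz
  induction hz' using Submodule.mul_induction_on' with
  | mem_mul_mem x hx f hf =>
    obtain ⟨x, hx, rfl⟩ := hx
    obtain ⟨f, hf, rfl⟩ := hf
    obtain ⟨a, ha⟩ := hφ ⟨f, hf⟩
    have h1 : compositumCoord hd.linearDisjoint htop φ ((x : N) * (f : N)) = a • x := by
      rw [mul_comm, compositumCoord_mul]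
      change φ f = _ at ha
      rw [ha, algebraMap_smul]
    change compositumCoord hd.linearDisjoint htop φ ((x : N) * (f : N)) ∈ _
    rw [h1]
    exact Subalgebra.smul_mem _ hx a
  | add x _ y _ hx hy =>
    rw [map_add]
    exact add_mem hx hy

end Integrality

/-! ### Associated orders under base change -/

section BaseChange

-- The ring `R` is a copy of `F ⊗ H`, identified with it by `τ`, and `σ` is the base change of `ρ`.
variable {A K N : Type*} [CommRing A] [Field K] [Algebra A K] [Field N] [Algebra K N]
  [Algebra A N] [IsScalarTower A K N] {E F : IntermediateField K N} [FiniteDimensional K N]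
  {H : Type*} [Ring H] [Algebra K H] {ρ : H →ₐ[K] Module.End K E}
  {R : Type*} [Ring R] [Algebra F R] {σ : R →ₐ[F] Module.End F N} {τ : F ⊗[K] H ≃ₐ[F] R}

theorem tensorCoord_mem_associatedOrder
    (hd : ArithmeticallyDisjoint A E F) (htop : E ⊔ F = ⊤)
    (hσ : ∀ t, σ (τ t) = baseChangeAction hd.linearDisjoint htop ρ t)
    {φ : F →ₗ[K] K}
    (hφ : ∀ y : integralClosure A F, ∃ a : A, φ y = algebraMap A K a) {t : R}
    (ht : t ∈ associatedOrder A σ) :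
    tensorCoord φ H (τ.symm t) ∈ associatedOrder A ρ := fun x hx => by
  rw [← compositumCoord_baseChangeAction_coe hd.linearDisjoint htop, ← hσ, τ.apply_symm_apply]
  exact hd.compositumCoord_mem htop hφ (ht _ (coe_mem_integralClosure.2 hx))

/-- A dual family for `O_F` over `A`, consisting of elements of `O_F` together with linear forms on
`F` that are integral on `O_F`. -/
structure IsDualFamily (A : Type*) [CommRing A] {K F : Type*} [Field K] [Field F] [Algebra K F]
    [Algebra A K] [Algebra A F] {ι : Type*} [Fintype ι] (f : ι → F) (φ : ι → F →ₗ[K] K) :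
    Prop where
  mem : ∀ i, f i ∈ integralClosure A F
  integral : ∀ i (y : integralClosure A F), ∃ a : A, φ i y = algebraMap A K a
  sum_smul : ∀ y, ∑ i, φ i y • f i = y

variable {ι : Type*} [Fintype ι] {f : ι → F} {φ : ι → F →ₗ[K] K}


theorem tmul_mem_associatedOrder
    (hd : ArithmeticallyDisjoint A E F) (htop : E ⊔ F = ⊤)
    (hσ : ∀ t, σ (τ t) = baseChangeAction hd.linearDisjoint htop ρ t)
    (hf : IsDualFamily A f φ) {g : F} (hg : g ∈ integralClosure A F) {h : H}
    (hh : h ∈ associatedOrder A ρ) :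
    τ (g ⊗ₜ[K] h) ∈ associatedOrder A σ := fun z hz => by
  rw [← sum_mul_compositumCoord hd.linearDisjoint htop hf.sum_smul z, hσ, map_sum]
  refine sum_mem fun i _ => ?_
  rw [baseChangeAction_tmul_mul]
  exact mul_mem (mul_mem (coe_mem_integralClosure.2 hg) (coe_mem_integralClosure.2 (hf.mem i)))
    (coe_mem_integralClosure.2 (hh _ (hd.compositumCoord_mem htop (hf.integral i) hz)))

/-- A basis of `O_E` over its associated order in `H` is also a basis of `O_N` over its associated
order in `F ⊗ H`. -/
theorem IsFreeOverAssociatedOrder.baseChange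
    (hd : ArithmeticallyDisjoint A E F) (htop : E ⊔ F = ⊤)
    (hσ : ∀ t, σ (τ t) = baseChangeAction hd.linearDisjoint htop ρ t)
    (hf : IsDualFamily A f φ)
    (hfree : IsFreeOverAssociatedOrder A ρ) :
    IsFreeOverAssociatedOrder A σ := by
  have hact (t : R) : σ t = baseChangeAction hd.linearDisjoint htop ρ (τ.symm t) := by
    rw [← hσ, τ.apply_symm_apply]
  obtain ⟨⟨I, b⟩⟩ := hfree.exists_basis
  let b' : I → integralClosure A N := fun i => ⟨(b i : E), coe_mem_integralClosure.2 (b i).2⟩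
  have hli : LinearIndependent (associatedOrder A σ) b' := by
    rw [linearIndependent_iff']
    intro s g hg i hi
    have h0 : ∑ i ∈ s, σ (g i) ((b i : E) : N) = 0 := by
      have := congrArg Subtype.val hg
      rwa [AddSubmonoidClass.coe_finsetSum] at this
    have h1 : ∀ k, tensorCoord (φ k) H (τ.symm (g i)) = 0 := fun k => by
      have h2 : ∑ i ∈ s, (⟨_, tensorCoord_mem_associatedOrder hd htop hσ (hf.integral k)
          (g i).2⟩ : associatedOrder A ρ) • b i = 0 := by
        apply Subtype.ext
        rw [AddSubmonoidClass.coe_finsetSum]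
        have h3 := congrArg (compositumCoord hd.linearDisjoint htop (φ k)) h0
        simp only [map_sum, map_zero, hact, compositumCoord_baseChangeAction_coe] at h3
        exact h3
      exact congrArg Subtype.val (linearIndependent_iff'.1 b.linearIndependent s _ h2 i hi)
    have h2 : τ.symm (g i) = 0 := by
      rw [← sum_tmul_tensorCoord hf.sum_smul (τ.symm (g i))]
      simp [h1]
    exact Subtype.ext ((map_eq_zero_iff _ τ.symm.injective).1 h2)
  have hspan : ⊤ ≤ Submodule.span (associatedOrder A σ) (Set.range b') := by
    intro z _
    have key (k : ι) (x : integralClosure A E) : (⟨(f k : N) * ((x : E) : N),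
        mul_mem (coe_mem_integralClosure.2 (hf.mem k)) (coe_mem_integralClosure.2 x.2)⟩ :
        integralClosure A N) ∈ Submodule.span (associatedOrder A σ) (Set.range b') := by
      have hx := b.linearCombination_repr x
      rw [Finsupp.linearCombination_apply, Finsupp.sum] at hx
      have h1 : (⟨(f k : N) * ((x : E) : N), mul_mem (coe_mem_integralClosure.2 (hf.mem k))
          (coe_mem_integralClosure.2 x.2)⟩ : integralClosure A N) =
          ∑ i ∈ (b.repr x).support, (⟨τ (f k ⊗ₜ[K] (b.repr x i : H)),
            tmul_mem_associatedOrder hd htop hσ hf (hf.mem k) (b.repr x i).2⟩ :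
            associatedOrder A σ) • b' i := by
        apply Subtype.ext
        have h2 : (x : E) = ∑ i ∈ (b.repr x).support, ρ (b.repr x i) (b i : E) := by
          have := congrArg Subtype.val hx.symm
          rwa [AddSubmonoidClass.coe_finsetSum] at this
        rw [AddSubmonoidClass.coe_finsetSum]
        change (f k : N) * ((x : E) : N) = ∑ i ∈ (b.repr x).support,
          σ (τ (f k ⊗ₜ[K] (b.repr x i : H))) ((b i : E) : N)
        simp only [hσ, baseChangeAction_tmul_coe]
        rw [← Finset.mul_sum, ← AddSubmonoidClass.coe_finsetSum, ← h2]
      rw [h1]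
      exact sum_mem fun i _ => Submodule.smul_mem _ _ (Submodule.subset_span ⟨i, rfl⟩)
    have hz : z = ∑ k, (⟨(f k : N) * (compositumCoord hd.linearDisjoint htop (φ k) (z : N) : N),
        mul_mem (coe_mem_integralClosure.2 (hf.mem k)) (coe_mem_integralClosure.2
          (hd.compositumCoord_mem htop (hf.integral k) z.2))⟩ : integralClosure A N) := by
      apply Subtype.ext
      rw [AddSubmonoidClass.coe_finsetSum]
      exact (sum_mul_compositumCoord hd.linearDisjoint htop hf.sum_smul (z : N)).symm
    rw [hz]
    exact sum_mem fun k _ =>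
      key k ⟨_, hd.compositumCoord_mem htop (hf.integral k) z.2⟩
  exact Module.Free.of_basis (Module.Basis.mk hli hspan)

/-- If `O_F` has an `A`-basis indexed by `ι`, then `O_N ≅ O_E^ι` and the associated order of `O_N`
is isomorphic to the `ι`-th power of that of `O_E`, compatibly with the action of the latter. A
generator of `O_N` therefore yields an isomorphism between these powers. -/
theorem nonempty_pi_linearEquiv_of_bijective_smul [DecidableEq ι]
    (hd : ArithmeticallyDisjoint A E F) (htop : E ⊔ F = ⊤)
    (hσ : ∀ t, σ (τ t) = baseChangeAction hd.linearDisjoint htop ρ t)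
    (hf : IsDualFamily A f φ)
    (horth : ∀ i j, φ i (f j) = if i = j then 1 else 0) (b : integralClosure A N)
    (hb : Function.Bijective
      fun t : associatedOrder A σ => t • b) :
    Nonempty ((ι → integralClosure A E) ≃ₗ[associatedOrder A ρ] (ι → associatedOrder A ρ)) := by
  have htensor (h : ι → H) (i : ι) : tensorCoord (φ i) H (∑ j, f j ⊗ₜ[K] h j) = h i := by
    simp [map_sum, tensorCoord_tmul, horth]
  -- `α` reassembles an element of the associated order of `O_N` from its coordinates, and `c` takes
  -- the coordinates of the image of `b` under this element.
  let α (h : ι → associatedOrder A ρ) :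
      associatedOrder A σ :=
    ⟨τ (∑ j, f j ⊗ₜ[K] (h j : H)), by
      rw [map_sum]
      exact sum_mem fun j _ =>
        tmul_mem_associatedOrder hd htop hσ hf (hf.mem j) (h j).2⟩
  have hα_add (h h') : α (h + h') = α h + α h' := Subtype.ext (by
    simp [α, TensorProduct.tmul_add, Finset.sum_add_distrib])
  have hα_smul (l : associatedOrder A ρ) (h) :
      (α (l • h) : R) = τ (1 ⊗ₜ[K] (l : H)) * (α h : R) := by
    simp only [α, ← map_mul]
    simp [Finset.mul_sum, Algebra.TensorProduct.tmul_mul_tmul]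
  let c (h : ι → associatedOrder A ρ) (i : ι) : integralClosure A E :=
    ⟨compositumCoord hd.linearDisjoint htop (φ i) ((α h • b : integralClosure A N) : N),
      hd.compositumCoord_mem htop (hf.integral i) (α h • b).2⟩
  let e : (ι → associatedOrder A ρ) →ₗ[associatedOrder A ρ] (ι → integralClosure A E) :=
    { toFun := c
      map_add' := fun h h' => funext fun i => Subtype.ext (by
        simp only [c, hα_add, add_smul, Pi.add_apply]
        exact map_add _ _ _)
      map_smul' := fun l h => funext fun i => Subtype.ext (by
        change compositumCoord hd.linearDisjoint htop (φ i)
          (σ (α (l • h)) (b : N)) =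
          ρ l (compositumCoord hd.linearDisjoint htop (φ i)
            (σ (α h) (b : N)))
        rw [hα_smul, map_mul, Module.End.mul_apply, hσ,
          compositumCoord_baseChangeAction_one_tmul]) }
  have hz (z : N) := sum_mul_compositumCoord hd.linearDisjoint htop hf.sum_smul z
  refine ⟨(LinearEquiv.ofBijective e ⟨?_, fun x => ?_⟩).symm⟩
  · refine (injective_iff_map_eq_zero e).2 fun h hh => ?_
    have h1 : α h • b = 0 := by
      apply Subtype.ext
      rw [← hz ((α h • b : integralClosure A N) : N)]
      refine Finset.sum_eq_zero fun i _ => ?_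
      have h2 : compositumCoord hd.linearDisjoint htop (φ i)
          ((α h • b : integralClosure A N) : N) = 0 := congrArg Subtype.val (congr_fun hh i)
      rw [h2, ZeroMemClass.coe_zero, mul_zero]
    have h2 : α h = 0 := hb.1 (h1.trans (zero_smul _ b).symm)
    funext i
    apply Subtype.ext
    rw [← htensor (fun j => (h j : H)) i]
    have h3 : ∑ j, f j ⊗ₜ[K] (h j : H) = 0 :=
      (map_eq_zero_iff _ τ.injective).1 (congrArg Subtype.val h2)
    rw [h3, map_zero]
    rfl
  · obtain ⟨t, ht⟩ := hb.2 (⟨∑ j, (f j : N) * ((x j : E) : N), sum_mem fun j _ =>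
      mul_mem (coe_mem_integralClosure.2 (hf.mem j)) (coe_mem_integralClosure.2 (x j).2)⟩ :
        integralClosure A N)
    refine ⟨fun i => ⟨_, tensorCoord_mem_associatedOrder hd htop hσ (hf.integral i) t.2⟩, ?_⟩
    funext i
    apply Subtype.ext
    have hαt :
        α (fun i => ⟨_, tensorCoord_mem_associatedOrder hd htop hσ (hf.integral i) t.2⟩) = t :=
      Subtype.ext ((congrArg τ (sum_tmul_tensorCoord hf.sum_smul (τ.symm (t : R)))).trans
        (τ.apply_symm_apply _))
    change compositumCoord hd.linearDisjoint htop (φ i)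
      ((α (fun i => ⟨_, tensorCoord_mem_associatedOrder hd htop hσ (hf.integral i) t.2⟩) • b :
        integralClosure A N) : N) = x i
    rw [hαt]
    have ht' : ((t • b : integralClosure A N) : N) = ∑ j, (f j : N) * ((x j : E) : N) :=
      congrArg Subtype.val ht
    rw [ht', map_sum]
    simp [compositumCoord_mul, horth]

end BaseChange

/-! ### Hopf–Galois structures and descent of freeness -/

namespace HopfGaloisStructure

variable {K L H : Type*} [Field K] [Field L] [Algebra K L] [Ring H] [HopfAlgebra K H]

/-- The canonical map restricts to the action on the elements `1 ⊗ h`. -/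
theorem action_injective (S : HopfGaloisStructure K L H) : Function.Injective S.action := by
  refine (injective_iff_map_eq_zero S.action).2 fun h hh => ?_
  have h1 : (1 : L) ⊗ₜ[K] h = 0 := S.bijective.1 (by
    rw [map_zero]
    simp [hh])
  exact (Algebra.TensorProduct.includeRight_injective (R := K) (A := L) (B := H)
    (algebraMap K L).injective) (by simpa using h1)

theorem finiteDimensional [FiniteDimensional K L] (S : HopfGaloisStructure K L H) :
    FiniteDimensional K H :=
  FiniteDimensional.of_injective S.action.toLinearMap S.action_injective

/-- Compare dimensions in `L ⊗ H ≃ End_K(L)`. -/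
theorem finrank_eq [FiniteDimensional K L] (S : HopfGaloisStructure K L H) :
    Module.finrank K H = Module.finrank K L := by
  have := (LinearEquiv.ofBijective _ S.bijective).finrank_eq
  rw [Module.finrank_tensorProduct, Module.finrank_linearMap] at this
  exact Nat.eq_of_mul_eq_mul_left Module.finrank_pos this

end HopfGaloisStructure

section Main

variable {A K N H : Type*} [CommRing A] [IsDedekindDomain A] [Field K] [Algebra A K]
  [IsFractionRing A K] [Field N] [Algebra K N] [Algebra A N] [IsScalarTower A K N]
  [FiniteDimensional K N] [Algebra.IsSeparable K N] {E F : IntermediateField K N}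
  [Ring H]

theorem exists_isDualFamily (F : IntermediateField K N) :
    ∃ (n : ℕ) (f : Fin n → F) (φ : Fin n → F →ₗ[K] K), IsDualFamily A f φ := by
  have : Module.Finite A (integralClosure A F) := IsIntegralClosure.finite A K F _
  have : Algebra.IsAlgebraic A F :=
    (IsFractionRing.comap_isAlgebraic_iff (K := K)).2 inferInstance
  have : Module.IsTorsionFree A F := Module.IsTorsionFree.trans_faithfulSMul A K F
  have : Module.FinitePresentation A (integralClosure A F) :=
    Module.finitePresentation_of_finite A _
  have : Module.Projective A (integralClosure A F) :=
    Module.Flat.projective_of_finitePresentation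
  obtain ⟨n, f, ψ, hψ⟩ := exists_dual_family_of_projective A (integralClosure A F)
  obtain ⟨φ, hφ, hsum⟩ := exists_dual_family_extending K f ψ hψ
  exact ⟨n, fun i => f i, φ, fun i => (f i).2, fun i y => ⟨_, hφ i y⟩, hsum⟩

theorem IsFreeOverAssociatedOrder.of_baseChange [Finite (MaximalSpectrum A)] [HopfAlgebra K H]
    (hd : ArithmeticallyDisjoint A E F) (htop : E ⊔ F = ⊤) (S : HopfGaloisStructure K E H)
    (hfree : IsFreeOverAssociatedOrder A (K := F) (L := N) (H := F ⊗[K] H)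
      (baseChangeAction hd.linearDisjoint htop S.action)) :
    IsFreeOverAssociatedOrder A S.action := by
  classical
  have : IsPrincipalIdealRing A := IsPrincipalIdealRing.of_finite_maximals (by
    rw [← MaximalSpectrum.range_asIdeal]
    exact Set.finite_range MaximalSpectrum.asIdeal)
  have hN : Algebra.IsAlgebraic A N :=
    (IsFractionRing.comap_isAlgebraic_iff (K := K)).2 inferInstance
  have hE : Algebra.IsAlgebraic A E :=
    (IsFractionRing.comap_isAlgebraic_iff (K := K)).2 inferInstance
  have hF : Algebra.IsAlgebraic A F :=
    (IsFractionRing.comap_isAlgebraic_iff (K := K)).2 inferInstance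
  have : Module.IsTorsionFree A E := Module.IsTorsionFree.trans_faithfulSMul A K E
  have : Module.IsTorsionFree A F := Module.IsTorsionFree.trans_faithfulSMul A K F
  have : Module.Finite A (integralClosure A E) := IsIntegralClosure.finite A K E _
  have : Module.Finite A (integralClosure A F) := IsIntegralClosure.finite A K F _
  have : Module.Finite A (integralClosure A N) := IsIntegralClosure.finite A K N _
  have : Module.Free A (integralClosure A E) := IsIntegralClosure.module_free A K E _
  have : Module.Free A (integralClosure A F) := IsIntegralClosure.module_free A K F _
  have hAK := IsFractionRing.injective A K
  have hAF : Function.Injective (algebraMap A F) := by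
    rw [IsScalarTower.algebraMap_eq A K F]
    exact (algebraMap K F).injective.comp hAK
  have : IsScalarTower A F N := ⟨fun a f n => smul_mul_assoc a (f : N) n⟩
  have := S.finiteDimensional
  have hdim : Module.finrank F (F ⊗[K] H) = Module.finrank F N := by
    rw [Module.finrank_baseChange, S.finrank_eq,
      ← (compositumEquiv hd.linearDisjoint htop).finrank_eq, Module.finrank_baseChange]
  obtain ⟨b, hb⟩ := IsFreeOverAssociatedOrder.exists_bijective_smul A (K := F) (L := N)
    (H := F ⊗[K] H) hAF hdim hfree
  let B := Module.Free.chooseBasis A (integralClosure A F)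
  obtain ⟨φ, hφ, hsum⟩ := exists_dual_family_extending K (fun i => B i) (fun i => B.coord i)
    B.sum_repr
  have hf : IsDualFamily A (fun i => (B i : F)) φ :=
    ⟨fun i => (B i).2, fun i y => ⟨_, hφ i y⟩, hsum⟩
  have horth : ∀ i j, φ i (B j) = if i = j then 1 else 0 := fun i j => by
    rw [hφ, B.coord_apply, B.repr_self, Finsupp.single_apply]
    split_ifs <;> simp_all
  obtain ⟨e⟩ := nonempty_pi_linearEquiv_of_bijective_smul (R := F ⊗[K] H) (τ := AlgEquiv.refl)
    hd htop (fun _ => rfl) hf horth b hb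
  have : Nonempty (Module.Free.ChooseBasisIndex A (integralClosure A F)) :=
    B.index_nonempty
  obtain ⟨m, hm⟩ := associatedOrder.exists_span_singleton_eq_top A hAK S.action_injective _ e
  exact isFreeOverAssociatedOrder_of_span_singleton_eq_top A hAK S.finrank_eq S.action m hm

end Main

theorem mainTheorem3
    {A K N H : Type*} [CommRing A] [IsDedekindDomain A]
    [Field K] [Algebra A K] [IsFractionRing A K]
    [Field N] [Algebra K N] [Algebra A N] [IsScalarTower A K N]
    [FiniteDimensional K N] [IsGalois K N]
    (J G' : Subgroup (N ≃ₐ[K] N)) [J.Normal] (hG : J.IsComplement' G')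
    (hd : ArithmeticallyDisjoint A
      (IntermediateField.fixedField G') (IntermediateField.fixedField J))
    [Ring H] [HopfAlgebra K H]
    (S : HopfGaloisStructure K (IntermediateField.fixedField G') H) :
    (IsFreeOverAssociatedOrder A S.action →
      IsFreeOverAssociatedOrder A (K := IntermediateField.fixedField J) (L := N)
        (H := IntermediateField.fixedField J ⊗[K] H)
        (baseChangeAction hd.linearDisjoint (fixedField_sup_fixedField_eq_top hG) S.action)) ∧
    (Finite (MaximalSpectrum A) →
      (IsFreeOverAssociatedOrder A S.action ↔
        IsFreeOverAssociatedOrder A (K := IntermediateField.fixedField J) (L := N)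
          (H := IntermediateField.fixedField J ⊗[K] H)
          (baseChangeAction hd.linearDisjoint (fixedField_sup_fixedField_eq_top hG)
            S.action))) := by
  have htop := fixedField_sup_fixedField_eq_top hG
  have hdir (hfree : IsFreeOverAssociatedOrder A S.action) :
      IsFreeOverAssociatedOrder A (K := IntermediateField.fixedField J) (L := N)
        (H := IntermediateField.fixedField J ⊗[K] H)
        (baseChangeAction hd.linearDisjoint htop S.action) := by
    obtain ⟨n, f, φ, hf⟩ := exists_isDualFamily (A := A) (IntermediateField.fixedField J)
    exact hfree.baseChange (R := IntermediateField.fixedField J ⊗[K] H) (τ := AlgEquiv.refl)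
      hd htop (fun _ => rfl) hf
  exact ⟨hdir, fun _ => ⟨hdir, IsFreeOverAssociatedOrder.of_baseChange hd htop S⟩⟩
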